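/- Let $d\ge 0$ be an integer, let $B^d$ be the open unit ball of Euclidean space $\mathbb R^d$ and $\partial B^d$ its unit sphere. Let $\mathbb R^{d,1}=\mathbb R^d\times\mathbb R$ carry the form $\langle x,y\rangle_{d,1}=\langle\bar x,\bar y\rangle_d-x_{d+1}y_{d+1}$, where $x=(\bar x,x_{d+1})$, let $\mathcal H^d=\{x:\langle x,x\rangle_{d,1}=-1,\ x_{d+1}>0\}$, and let $O_+(d,1)$ be the group of linear isometries of $\mathbb R^{d,1}$ preserving $\mathcal H^d$. It acts on $B^d$ (Klein model) by $A\cdot x=\overline{A(x,1)}\,/\,(A(x,1))_{d+1}$. Put $L(x)=\sqrt{1-\|x\|^2}$. Let $\Gamma$ be a subgroup of $O_+(d,1)$ acting properly discontinuously on $\mathcal H^d$ with compact quotient $\mathcal H^d/\Gamma$ (for example, $\mathcal H^d/\Gamma$ a compact oriented hyperbolic manifold). Let $Z^1(\Gamma,\mathbb R^{d,1})$ be the vector space of cocycles, i.e. of maps $\tau:\Gamma\to\mathbb R^{d,1}$ with $\tau(AB)=\tau(A)+A(\tau(B))$ for all $A,B\in\Gamma$; $\tau$ is a coboundary if there is $v\in\mathbb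 R^{d,1}$ with $\tau(A)=Av-v$ for all $A\in\Gamma$. A continuous map $h:B^d\to\mathbb R$ is called $\tau$-equivariant if for all $A\in\Gamma$ and $x\in B^d$ $$h(x)=\frac{L(x)}{L(A^{-1}\cdot x)}\,h(A^{-1}\cdot x)+\langle x,\overline{\tau(A)}\rangle_d-\tau(A)_{d+1}.$$ Then for every $\tau\in Z^1(\Gamma,\mathbb R^{d,1})$ there exist $\tau$-equivariant maps, and there is a unique continuous map $b_\tau:\partial B^d\to\mathbb R$ such that every $\tau$-equivariant map extends continuously to the closed ball $B^d\cup\partial B^d$ with the values $b_\tau$ on $\partial B^d$. Moreover: 1. $b_{\alpha\tau_1+\tau_2}=\alpha b_{\tau_1}+b_{\tau_2}$ for all $\tau_1,\tau_2\in Z^1(\Gamma,\mathbb R^{d,1})$ and $\alpha\in\mathbb R$; 2. $\tau$ is a coboundary if and only if $b_\tau$ is the restriction to $\partial B^d$ of an affine map $\mathbb R^d\to\mathbb R$. -/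

import Mathlib

namespace CoMinkowski

/-- Minkowski space `ℝ^{d,1}`: pairs of a horizontal component in Euclidean `ℝ^d` and a vertical
component in `ℝ`. -/
abbrev Mink (d : ℕ) : Type := EuclideanSpace ℝ (Fin d) × ℝ

/-- The Lorentzian bilinear form `x₁y₁ + ⋯ + x_d y_d - x_{d+1} y_{d+1}`. -/
noncomputable def form {d : ℕ} (x y : Mink d) : ℝ := inner ℝ x.1 y.1 - x.2 * y.2

/-- The hyperboloid model of hyperbolic `d`-space. -/
def hyperboloid (d : ℕ) : Set (Mink d) := {x | form x x = -1 ∧ 0 < x.2}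

/-- The group `O₊(d,1)` of linear isometries of the Lorentzian form preserving the hyperboloid. -/
def OPlus (d : ℕ) : Subgroup (Mink d ≃ₗ[ℝ] Mink d) where
  carrier := {A | (∀ x y, form (A x) (A y) = form x y) ∧
    ∀ x, A x ∈ hyperboloid d ↔ x ∈ hyperboloid d}
  one_mem' := ⟨fun _ _ => rfl, fun _ => Iff.rfl⟩
  mul_mem' := fun {A B} hA hB =>
    ⟨fun x y => (hA.1 (B x) (B y)).trans (hB.1 x y),
      fun x => (hA.2 (B x)).trans (hB.2 x)⟩
  inv_mem' := fun {A} hA => by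
    have h : ∀ x, A (A⁻¹ x) = x := fun x => A.apply_symm_apply x
    refine ⟨fun x y => ?_, fun x => ?_⟩
    · rw [← hA.1, h, h]
    · rw [← hA.2, h]

/-- The action of `O₊(d,1)` on the hyperboloid. -/
instance (d : ℕ) : MulAction (OPlus d) (hyperboloid d) where
  smul A x := ⟨A.1 x.1, (A.2.2 x.1).2 x.2⟩
  one_smul _ := rfl
  mul_smul _ _ _ := rfl

variable {d : ℕ}

/-- `L(x) = √(1 - ‖x‖²)`. -/
noncomputable def L (x : EuclideanSpace ℝ (Fin d)) : ℝ := Real.sqrt (1 - ‖x‖ ^ 2)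

/-- The action of `A ∈ O₊(d,1)` on the Klein ball: `A • x` is determined by
`(A (x, 1))_{d+1} • (A • x, 1) = A (x, 1)`. -/
noncomputable def klein (A : OPlus d) (x : EuclideanSpace ℝ (Fin d)) :
    EuclideanSpace ℝ (Fin d) :=
  ((A.1 (x, 1)).2)⁻¹ • (A.1 (x, 1)).1

/-- The action of an isometry `(A, v)` of co-Minkowski space on functions on the open unit ball
(the graph of the new function is the image of the graph of `h`). Functions on the ball are
represented by functions on `ℝ^d`, whose values outside the ball play no role. -/
noncomputable def act (A : OPlus d) (v : Mink d) (h : EuclideanSpace ℝ (Fin d) → ℝ)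
    (x : EuclideanSpace ℝ (Fin d)) : ℝ :=
  L x / L (klein A⁻¹ x) * h (klein A⁻¹ x) + inner ℝ x v.1 - v.2

/-- The space `Z¹(Γ, ℝ^{d,1})` of cocycles. -/
def cocycles (Γ : Subgroup (OPlus d)) : Submodule ℝ (Γ → Mink d) where
  carrier := {τ | ∀ A B : Γ, τ (A * B) = τ A + A.1.1 (τ B)}
  zero_mem' := fun A B => by simp
  add_mem' := fun {σ τ} hσ hτ A B => by
    simp only [Pi.add_apply, hσ A B, hτ A B, map_add]
    abel
  smul_mem' := fun c τ hτ A B => by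
    simp only [Pi.smul_apply, hτ A B, map_smul, smul_add]

/-- A cocycle is a coboundary if it is of the form `A ↦ A v - v`. -/
def IsCoboundary {Γ : Subgroup (OPlus d)} (τ : cocycles Γ) : Prop :=
  ∃ v : Mink d, ∀ A : Γ, τ.1 A = A.1.1 v - v

/-- `h` is a `τ`-equivariant map on the open unit ball. -/
def IsEquivariant {Γ : Subgroup (OPlus d)} (τ : cocycles Γ)
    (h : EuclideanSpace ℝ (Fin d) → ℝ) : Prop :=
  ContinuousOn h (Metric.ball 0 1) ∧
    ∀ A : Γ, ∀ x ∈ Metric.ball (0 : EuclideanSpace ℝ (Fin d)) 1, act A.1 (τ.1 A) h x = h x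

/-- The map `h` on the open unit ball extends continuously to the closed ball, with boundary
values `b`. -/
def ExtendsAs (h : EuclideanSpace ℝ (Fin d) → ℝ)
    (b : C(Metric.sphere (0 : EuclideanSpace ℝ (Fin d)) 1, ℝ)) : Prop :=
  ∃ H : EuclideanSpace ℝ (Fin d) → ℝ, ContinuousOn H (Metric.closedBall 0 1) ∧
    (∀ x ∈ Metric.ball (0 : EuclideanSpace ℝ (Fin d)) 1, H x = h x) ∧
    ∀ x : Metric.sphere (0 : EuclideanSpace ℝ (Fin d)) 1, H x = b x

/-- `b` is the restriction to the unit sphere of an affine map on `ℝ^d`. -/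
def IsAffineRestriction (b : C(Metric.sphere (0 : EuclideanSpace ℝ (Fin d)) 1, ℝ)) : Prop :=
  ∃ f : EuclideanSpace ℝ (Fin d) →ᵃ[ℝ] ℝ,
    ∀ x : Metric.sphere (0 : EuclideanSpace ℝ (Fin d)) 1, b x = f x

end CoMinkowski

/-!
The affine functions on the ball are `x ↦ ⟨(x, 1), v⟩` for `v ∈ ℝ^{d,1}`, and a `τ`-equivariant map
is one that changes under `A ∈ Γ` by the affine function of `τ(A)`. Hence averaging these affine
functions against a `Γ`-equivariant partition of unity of the hyperboloid yields an equivariant map.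

Let `h` be equivariant. Some `A ∈ Γ` moves a given point `x` into a fixed compact set, on which
`h / L` is bounded; moving back, `h` differs from an affine function by at most `C * L` on a
hyperbolic ball of fixed radius around `x`. Along a radius, at distance `s` from the sphere,
this is an affine approximation with error `O(√s)` on `[s/4, s]`. Comparing the slopes at
consecutive dyadic scales bounds the oscillation of `h` on `(0, s]` by `O(√s)`, uniformly in the
radius, so `h` is uniformly continuous and extends to the closed ball. For `τ = 0` the affine
functions vanish and `|h| ≤ C * L`, so the boundary values are zero and in general depend only
on `τ`.

The map `x ↦ -⟨(x, 1), v⟩` is equivariant for the coboundary of `v`, which gives the affine boundary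
values. Conversely, passing to the boundary in the equivariance relation shows that `b_τ = 0`
forces `⟨(x, 1), τ(A)⟩ = 0` on the sphere, hence `τ = 0` because the light cone spans `ℝ^{d,1}`
for `d > 0`.
-/

namespace CoMinkowski

open Metric Filter Topology Function

variable {d : ℕ}

section Averaging

variable {G X : Type*} [Group G] [TopologicalSpace X] [MulAction G X]

lemma locallyFinite_support_comp_inv_smul [WeaklyLocallyCompactSpace X]
    [ProperlyDiscontinuousSMul G X] {M : Type*} [Zero M] {φ : X → M} (hφ : HasCompactSupport φ) :
    LocallyFinite fun g : G => support fun x => φ (g⁻¹ • x) := by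
  intro x
  obtain ⟨N, hN, hxN⟩ := exists_compact_mem_nhds x
  refine ⟨N, hxN, (ProperlyDiscontinuousSMul.finite_disjoint_inter_image hφ hN).subset ?_⟩
  rintro g ⟨y, hy, hyN⟩
  exact ⟨y, ⟨g⁻¹ • y, subset_tsupport φ hy, smul_inv_smul g y⟩, hyN⟩

variable [ContinuousConstSMul G X] [CompactSpace (Quotient (MulAction.orbitRel G X))]

lemma exists_isCompact_forall_exists_smul_mem [WeaklyLocallyCompactSpace X] :
    ∃ K : Set X, IsCompact K ∧ ∀ x : X, ∃ g : G, g • x ∈ K := by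
  choose N hN hxN using fun x : X => exists_compact_mem_nhds x
  let π : X → Quotient (MulAction.orbitRel G X) := Quotient.mk _
  have hπ : IsOpenQuotientMap π := MulAction.isOpenQuotientMap_quotientMk
  have hcover : Set.univ ⊆ ⋃ x, π '' interior (N x) := by
    rintro q -
    obtain ⟨x, rfl⟩ := hπ.surjective q
    exact Set.mem_iUnion.2 ⟨x, x, mem_interior_iff_mem_nhds.2 (hxN x), rfl⟩
  obtain ⟨t, ht⟩ := isCompact_univ.elim_finite_subcover _
    (fun x => hπ.isOpenMap _ isOpen_interior) hcover
  refine ⟨⋃ x ∈ t, N x, t.isCompact_biUnion fun x _ => hN x, fun y => ?_⟩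
  obtain ⟨x, hxt, z, hz, hzy⟩ := Set.mem_iUnion₂.1 (ht (Set.mem_univ (π y)))
  obtain ⟨g, rfl⟩ := MulAction.orbitRel_apply.1 (Quotient.exact hzy)
  exact ⟨g, Set.mem_biUnion hxt (interior_subset hz)⟩

variable [LocallyCompactSpace X] [RegularSpace X] [ProperlyDiscontinuousSMul G X]

lemma exists_equivariant_partitionOfUnity :
    ∃ ρ : G → X → ℝ, (∀ g, Continuous (ρ g)) ∧ (LocallyFinite fun g => support (ρ g)) ∧
      (∀ x, ∑ᶠ g, ρ g x = 1) ∧ ∀ g k x, ρ (g * k) x = ρ k (g⁻¹ • x) := by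
  obtain ⟨K, hK, hKG⟩ := exists_isCompact_forall_exists_smul_mem (G := G) (X := X)
  obtain ⟨φ, hφK, -, hφ, hφ01⟩ :=
    exists_continuous_one_zero_of_isCompact hK isClosed_empty (Set.disjoint_empty K)
  let w : G → X → ℝ := fun g x => φ (g⁻¹ • x)
  have hw_cont (g : G) : Continuous (w g) := φ.continuous.comp (continuous_const_smul g⁻¹)
  have hw_lf : LocallyFinite fun g => support (w g) := locallyFinite_support_comp_inv_smul hφ
  have hw_mul (g k : G) (x : X) : w (g * k) x = w k (g⁻¹ • x) := by
    simp only [w, mul_inv_rev, mul_smul]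
  have hsum_pos (x : X) : 0 < ∑ᶠ g, w g x := by
    obtain ⟨g, hg⟩ := hKG x
    refine finsum_pos (fun g => (hφ01 _).1) ⟨g⁻¹, ?_⟩ (hw_lf.point_finite x)
    simp only [w, inv_inv, hφK hg, Pi.one_apply, zero_lt_one]
  have hsum_inv (g : G) (x : X) : ∑ᶠ k, w k (g⁻¹ • x) = ∑ᶠ k, w k x := by
    simp only [← hw_mul]
    exact finsum_comp_equiv (Equiv.mulLeft g) (f := fun k => w k x)
  refine ⟨fun g x => (∑ᶠ k, w k x)⁻¹ * w g x, fun g => ?_, ?_, fun x => ?_, fun g k x => ?_⟩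
  · exact ((continuous_finsum hw_cont hw_lf).inv₀ fun x => (hsum_pos x).ne').mul (hw_cont g)
  · exact hw_lf.subset fun g x hx => right_ne_zero_of_mul hx
  · rw [← mul_finsum, inv_mul_cancel₀ (hsum_pos x).ne']
  · simp only [hw_mul, hsum_inv]

/-- Every continuous cocycle with values in functions on `X` is the coboundary of its average
against an equivariant partition of unity. -/
lemma exists_continuous_eq_inv_smul_add {E : Type*} [AddCommGroup E] [Module ℝ E]
    [TopologicalSpace E] [ContinuousAdd E] [ContinuousSMul ℝ E] {c : G → X → E}
    (hc : ∀ g, Continuous (c g)) (hmul : ∀ g k x, c (g * k) x = c g x + c k (g⁻¹ • x)) :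
    ∃ u : X → E, Continuous u ∧ ∀ g x, u x = u (g⁻¹ • x) + c g x := by
  obtain ⟨ρ, hρ_cont, hρ_lf, hρ_sum, hρ_mul⟩ :=
    exists_equivariant_partitionOfUnity (G := G) (X := X)
  have hρc_lf : LocallyFinite fun g => support fun x => ρ g x • c g x :=
    hρ_lf.subset fun g => support_smul_subset_left (ρ g) (c g)
  refine ⟨fun x => ∑ᶠ g, ρ g x • c g x,
    continuous_finsum (fun g => (hρ_cont g).smul (hc g)) hρc_lf, fun g x => ?_⟩
  have hfin : (support fun k => ρ k (g⁻¹ • x)).Finite := hρ_lf.point_finite (g⁻¹ • x)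
  calc ∑ᶠ k, ρ k x • c k x
      = ∑ᶠ k, ρ (g * k) x • c (g * k) x :=
        (finsum_comp_equiv (Equiv.mulLeft g) (f := fun k => ρ k x • c k x)).symm
    _ = ∑ᶠ k, (ρ k (g⁻¹ • x) • c k (g⁻¹ • x) + ρ k (g⁻¹ • x) • c g x) := by
        simp only [hρ_mul, hmul, smul_add, add_comm]
    _ = ∑ᶠ k, ρ k (g⁻¹ • x) • c k (g⁻¹ • x) + ∑ᶠ k, ρ k (g⁻¹ • x) • c g x :=
        finsum_add_distrib (hρc_lf.point_finite (g⁻¹ • x))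
          (hfin.subset (support_smul_subset_left _ _))
    _ = ∑ᶠ k, ρ k (g⁻¹ • x) • c k (g⁻¹ • x) + c g x := by
        rw [← finsum_smul' hfin, hρ_sum, one_smul]

end Averaging

section Oscillation

lemma dyadic_induction {P : ℝ → Prop} (base : ∀ s, 1 / 2 ≤ s → s ≤ 1 → P s)
    (step : ∀ s, 0 < s → s ≤ 1 / 2 → P (2 * s) → P s) {s : ℝ} (hs : 0 < s) (hs1 : s ≤ 1) :
    P s := by
  have of_pow_le (n : ℕ) : ∀ s : ℝ, (1 / 2 : ℝ) ^ (n + 1) ≤ s → s ≤ 1 → P s := by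
    induction n with
    | zero => exact fun s hs => base s (by simpa using hs)
    | succ n ih =>
      intro s hs hs1
      rcases le_total (1 / 2) s with hs2 | hs2
      · exact base s hs2 hs1
      · exact step s (lt_of_lt_of_le (by positivity) hs) hs2
          (ih (2 * s) (by rw [pow_succ] at hs; linarith) (by linarith))
  obtain ⟨n, hn⟩ := exists_pow_lt_of_lt_one hs (by norm_num : (1 / 2 : ℝ) < 1)
  exact of_pow_le n s ((pow_le_pow_of_le_one (by norm_num) (by norm_num) n.le_succ).trans hn.le) hs1

variable {γ C D : ℝ} {g : ℝ → ℝ}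

lemma abs_sub_le_of_affine_approx {e p q s t : ℝ} (hs : 0 ≤ s) (hst : s / 2 ≤ t) (hts : t ≤ s)
    (h2s : |g (2 * s) - (p + q * (2 * s))| ≤ e) (h1s : |g s - (p + q * s)| ≤ e)
    (ht : |g t - (p + q * t)| ≤ e) : |g t - g s| ≤ 1 / 2 * |g s - g (2 * s)| + 3 * e := by
  have hslope : |q * s| ≤ |g s - g (2 * s)| + 2 * e := by
    rw [show q * s = -(g s - g (2 * s)) + (g s - (p + q * s)) -
      (g (2 * s) - (p + q * (2 * s))) by ring]
    linarith [abs_sub (-(g s - g (2 * s)) + (g s - (p + q * s))) (g (2 * s) - (p + q * (2 * s))),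
      abs_add_le (-(g s - g (2 * s))) (g s - (p + q * s)), abs_neg (g s - g (2 * s))]
  have hincr : |q * (s - t)| ≤ 1 / 2 * |q * s| := by
    rw [abs_mul, abs_mul, abs_of_nonneg hs, abs_of_nonneg (by linarith : 0 ≤ s - t)]
    nlinarith [abs_nonneg q]
  rw [show g t - g s = (g t - (p + q * t)) - (g s - (p + q * s)) - q * (s - t) by ring]
  linarith [abs_sub ((g t - (p + q * t)) - (g s - (p + q * s))) (q * (s - t)),
    abs_sub (g t - (p + q * t)) (g s - (p + q * s))]

/-- Since `γ < 1`, halving the scale halves the increment of an affine function but divides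
`s ^ γ` by less than `2`, so the bound improves from one scale to the next. -/
lemma abs_sub_le_rpow_of_affine_approx
    (hD : 2 ^ γ * (1 / 2 * D + 3 * C) ≤ D)
    (haffine : ∀ s, 0 < s → s ≤ 1 → ∃ p q : ℝ, ∀ t, s / 4 ≤ t → t ≤ s →
      |g t - (p + q * t)| ≤ C * s ^ γ)
    (hbase : ∀ s t, 1 / 2 ≤ s → s ≤ 1 → s / 2 ≤ t → t ≤ s → |g t - g s| ≤ D * s ^ γ)
    {s t : ℝ} (hs : 0 < s) (hs1 : s ≤ 1) (hst : s / 2 ≤ t) (hts : t ≤ s) :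
    |g t - g s| ≤ D * s ^ γ := by
  refine dyadic_induction
    (P := fun s => ∀ t, s / 2 ≤ t → t ≤ s → |g t - g s| ≤ D * s ^ γ)
    (fun s hs2 hs1 t => hbase s t hs2 hs1) (fun s hs hs2 ih t hst hts => ?_) hs hs1 t hst hts
  obtain ⟨p, q, hpq⟩ := haffine (2 * s) (by linarith) (by linarith)
  have hdouble := ih s (by linarith) (by linarith)
  have hpow : (2 * s) ^ γ = 2 ^ γ * s ^ γ := Real.mul_rpow (by norm_num) hs.le
  calc |g t - g s| ≤ 1 / 2 * |g s - g (2 * s)| + 3 * (C * (2 * s) ^ γ) :=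
        abs_sub_le_of_affine_approx hs.le hst hts (hpq _ (by linarith) le_rfl)
          (hpq _ (by linarith) (by linarith)) (hpq _ (by linarith) (by linarith))
    _ ≤ 1 / 2 * (D * (2 * s) ^ γ) + 3 * (C * (2 * s) ^ γ) := by gcongr
    _ = 2 ^ γ * (1 / 2 * D + 3 * C) * s ^ γ := by rw [hpow]; ring
    _ ≤ D * s ^ γ := by gcongr

lemma dist_le_rpow_of_forall_half_le {α : Type*} [PseudoMetricSpace α] {f : ℝ → α} (hγ : 0 < γ)
    (hf : ∀ s t, 0 < s → s ≤ 1 → s / 2 ≤ t → t ≤ s → dist (f t) (f s) ≤ D * s ^ γ)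
    {s t : ℝ} (ht : 0 < t) (hts : t ≤ s) (hs1 : s ≤ 1) :
    dist (f t) (f s) ≤ D / (1 - (1 / 2) ^ γ) * s ^ γ := by
  have hr1 : 0 < 1 - (1 / 2 : ℝ) ^ γ :=
    sub_pos.2 (Real.rpow_lt_one (by norm_num) (by norm_num) hγ)
  have hD : 0 ≤ D := by simpa using hf 1 1 one_pos le_rfl (by norm_num) le_rfl
  have hDK : D ≤ D / (1 - (1 / 2) ^ γ) := le_div_self hD hr1 (sub_le_self _ (by positivity))
  have of_ratio {r : ℝ} (hr : 0 < r) (hr1 : r ≤ 1) : ∀ s, 0 < s → s ≤ 1 →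
      dist (f (r * s)) (f s) ≤ D / (1 - (1 / 2) ^ γ) * s ^ γ := by
    refine dyadic_induction
      (P := fun r => ∀ s, 0 < s → s ≤ 1 →
        dist (f (r * s)) (f s) ≤ D / (1 - (1 / 2) ^ γ) * s ^ γ)
      (fun r hr2 hr1 s hs hs1 => ?_) (fun r hr hr2 ih s hs hs1 => ?_) hr hr1
    · exact (hf s (r * s) hs hs1 (by nlinarith) (by nlinarith)).trans (by gcongr)
    · calc dist (f (r * s)) (f s)
          ≤ dist (f (2 * r * (s / 2))) (f (s / 2)) + dist (f (s / 2)) (f s) := by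
            rw [show r * s = 2 * r * (s / 2) by ring]
            exact dist_triangle _ _ _
        _ ≤ D / (1 - (1 / 2) ^ γ) * (s / 2) ^ γ + D * s ^ γ :=
            add_le_add (ih _ (by linarith) (by linarith))
              (hf _ _ hs hs1 le_rfl (by linarith))
        _ = D / (1 - (1 / 2) ^ γ) * s ^ γ := by
            rw [show s / 2 = 1 / 2 * s by ring, Real.mul_rpow (by norm_num) hs.le]
            field_simp
            ring
  have hs : 0 < s := ht.trans_le hts
  simpa only [div_mul_cancel₀ t hs.ne'] using
    of_ratio (div_pos ht hs) ((div_le_one hs).2 hts) s hs hs1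

lemma exists_forall_abs_sub_le_rpow (hγ0 : 0 < γ) (hγ1 : γ < 1) (C M : ℝ) :
    ∃ K : ℝ, ∀ g : ℝ → ℝ,
      (∀ s, 0 < s → s ≤ 1 → ∃ p q : ℝ, ∀ t, s / 4 ≤ t → t ≤ s →
        |g t - (p + q * t)| ≤ C * s ^ γ) →
      (∀ s, 1 / 4 ≤ s → s ≤ 1 → |g s| ≤ M) →
      ∀ s t, 0 < t → t ≤ s → s ≤ 1 → |g t - g s| ≤ K * s ^ γ := by
  have hcontract : (0 : ℝ) < 1 - 2 ^ γ / 2 := by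
    have : (2 : ℝ) ^ γ < 2 ^ (1 : ℝ) := Real.rpow_lt_rpow_of_exponent_lt (by norm_num) hγ1
    rw [Real.rpow_one] at this
    linarith
  set D := max (3 * 2 ^ γ * C / (1 - 2 ^ γ / 2)) (4 * M)
  have hD : 2 ^ γ * (1 / 2 * D + 3 * C) ≤ D := by
    have := (div_le_iff₀ hcontract).1 (le_max_left _ _ : _ ≤ D)
    linarith
  refine ⟨D / (1 - (1 / 2) ^ γ), fun g haffine hM s t ht hts hs1 => ?_⟩
  refine dist_le_rpow_of_forall_half_le (f := g) hγ0 (fun s t hs hs1 hst hts =>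
    abs_sub_le_rpow_of_affine_approx hD haffine (fun s t hs2 hs1 hst hts => ?_) hs hs1 hst hts)
    ht hts hs1
  have hM0 : 0 ≤ M := (abs_nonneg _).trans (hM 1 (by norm_num) le_rfl)
  have hpow : 1 / 2 ≤ s ^ γ :=
    hs2.trans (Real.self_le_rpow_of_le_one (by linarith) hs1 hγ1.le)
  calc |g t - g s| ≤ |g t| + |g s| := abs_sub _ _
    _ ≤ M + M := add_le_add (hM t (by linarith) (by linarith)) (hM s (by linarith) hs1)
    _ = 4 * M * (1 / 2) := by ring
    _ ≤ D * s ^ γ := by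
        gcongr
        exact le_max_right _ _

end Oscillation

section Extension

lemma exists_tendsto_of_uniformContinuousOn {α β : Type*} [UniformSpace α] [UniformSpace β]
    [CompleteSpace β] {f : α → β} {s : Set α} (hf : UniformContinuousOn f s) {x : α}
    (hx : x ∈ closure s) : ∃ y, Tendsto f (𝓝[s] x) (𝓝 y) := by
  have := mem_closure_iff_nhdsWithin_neBot.1 hx
  refine cauchy_map_iff_exists_tendsto.1 (cauchy_map_iff.2 ⟨this, hf.mono_left (le_inf ?_ ?_)⟩)
  · exact (Filter.prod_mono nhdsWithin_le_nhds nhdsWithin_le_nhds).trans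
      (nhds_prod_eq.ge.trans (nhds_le_uniformity x))
  · rw [← prod_principal_principal]
    exact Filter.prod_mono inf_le_right inf_le_right

variable {E : Type*} [NormedAddCommGroup E] [NormedSpace ℝ E] {r : ℝ} {x : E}

/-- The retraction of a normed space onto the closed ball of radius `r` along the rays from the
origin; it compares values of a function near the boundary of a ball with values deep inside. -/
noncomputable def radialRetraction (r : ℝ) (x : E) : E := (r / max r ‖x‖) • x

lemma continuous_radialRetraction (hr : 0 < r) : Continuous (radialRetraction r : E → E) :=
  (continuous_const.div (by fun_prop) fun _ => (lt_max_of_lt_left hr).ne').smul continuous_id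

lemma radialRetraction_of_norm_le (hr : 0 < r) (hx : ‖x‖ ≤ r) : radialRetraction r x = x := by
  rw [radialRetraction, max_eq_left hx, div_self hr.ne', one_smul]

lemma radialRetraction_of_le_norm (hx : r ≤ ‖x‖) : radialRetraction r x = r • ‖x‖⁻¹ • x := by
  rw [radialRetraction, max_eq_right hx, smul_smul, div_eq_mul_inv]

lemma norm_radialRetraction_le (hr : 0 < r) (x : E) : ‖radialRetraction r x‖ ≤ r := by
  rw [radialRetraction, norm_smul, norm_div, Real.norm_of_nonneg hr.le,
    Real.norm_of_nonneg (le_max_of_le_left hr.le), div_mul_eq_mul_div]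
  exact div_le_of_le_mul₀ (le_max_of_le_left hr.le) hr.le (by gcongr; exact le_max_right _ _)

/-- The compositions of `f` with the radial retractions are uniformly continuous by compactness and
approximate `f` uniformly. -/
lemma uniformContinuousOn_ball_of_radial [ProperSpace E] {α : Type*} [PseudoMetricSpace α]
    {f : E → α} (hf : ContinuousOn f (ball 0 1))
    (hrad : ∀ ε > 0, ∃ s : ℝ, 0 < s ∧ s < 1 ∧ ∀ ω : E, ‖ω‖ = 1 → ∀ t, 0 < t → t ≤ s →
      dist (f ((1 - t) • ω)) (f ((1 - s) • ω)) ≤ ε) :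
    UniformContinuousOn f (ball 0 1) := by
  rw [Metric.uniformContinuousOn_iff]
  intro ε hε
  obtain ⟨s, hs0, hs1, hs⟩ := hrad (ε / 3) (by positivity)
  have hr : 0 < 1 - s := by linarith
  have hdist (x : E) (hx : x ∈ ball 0 1) : dist (f x) (f (radialRetraction (1 - s) x)) ≤ ε / 3 := by
    rcases le_total ‖x‖ (1 - s) with hxs | hxs
    · rw [radialRetraction_of_norm_le hr hxs, dist_self]
      positivity
    · have hx0 : 0 < ‖x‖ := hr.trans_le hxs
      have hx_eq : (1 - (1 - ‖x‖)) • ‖x‖⁻¹ • x = x := by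
        rw [sub_sub_cancel, smul_inv_smul₀ hx0.ne']
      have := hs (‖x‖⁻¹ • x) (norm_smul_inv_norm (norm_pos_iff.1 hx0)) (1 - ‖x‖)
        (by linarith [mem_ball_zero_iff.1 hx]) (by linarith)
      rwa [hx_eq, ← radialRetraction_of_le_norm hxs] at this
  have hcont : ContinuousOn (f ∘ radialRetraction (1 - s)) (closedBall 0 1) :=
    hf.comp (continuous_radialRetraction hr).continuousOn fun x _ =>
      mem_ball_zero_iff.2 ((norm_radialRetraction_le hr x).trans_lt (by linarith))
  obtain ⟨δ, hδ, hδε⟩ := Metric.uniformContinuousOn_iff.1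
    ((isCompact_closedBall 0 1).uniformContinuousOn_of_continuous hcont) (ε / 3) (by positivity)
  refine ⟨δ, hδ, fun x hx y hy hxy => ?_⟩
  calc dist (f x) (f y)
      ≤ dist (f x) (f (radialRetraction (1 - s) x)) +
        dist (f (radialRetraction (1 - s) x)) (f (radialRetraction (1 - s) y)) +
        dist (f (radialRetraction (1 - s) y)) (f y) := dist_triangle4 _ _ _ _
    _ < ε / 3 + ε / 3 + ε / 3 :=
        add_lt_add_of_lt_of_le (add_lt_add_of_le_of_lt (hdist x hx)
          (hδε x (ball_subset_closedBall hx) y (ball_subset_closedBall hy) hxy))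
          ((dist_comm _ _).trans_le (hdist y hy))
    _ = ε := by ring

end Extension

section LorentzianForm

lemma form_smul_left (a : ℝ) (X Y : Mink d) : form (a • X) Y = a * form X Y := by
  simp only [form, Prod.smul_fst, Prod.smul_snd, real_inner_smul_left, smul_eq_mul]
  ring

lemma form_smul_right (a : ℝ) (X Y : Mink d) : form X (a • Y) = a * form X Y := by
  simp only [form, Prod.smul_fst, Prod.smul_snd, real_inner_smul_right, smul_eq_mul]
  ring

lemma form_add_right (X Y Z : Mink d) : form X (Y + Z) = form X Y + form X Z := by
  simp only [form, Prod.fst_add, Prod.snd_add, inner_add_right]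
  ring

lemma form_sub_right (X Y Z : Mink d) : form X (Y - Z) = form X Y - form X Z := by
  simp only [form, Prod.fst_sub, Prod.snd_sub, inner_sub_right]
  ring

lemma form_zero_right (X : Mink d) : form X 0 = 0 := by
  simp [form]

lemma form_self (X : Mink d) : form X X = ‖X.1‖ ^ 2 - X.2 ^ 2 := by
  rw [form, real_inner_self_eq_norm_sq, pow_two X.2]

lemma form_mk_one (x : EuclideanSpace ℝ (Fin d)) (v : Mink d) :
    form (x, 1) v = inner ℝ x v.1 - v.2 := by
  rw [form, one_mul]

lemma continuous_form_left (v : Mink d) : Continuous fun X : Mink d => form X v := by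
  unfold form
  fun_prop

lemma continuous_form_mk_one (v : Mink d) :
    Continuous fun x : EuclideanSpace ℝ (Fin d) => form (x, 1) v :=
  (continuous_form_left v).comp (by fun_prop)

lemma eq_zero_of_forall_form_eq_zero [Nontrivial (EuclideanSpace ℝ (Fin d))] {v : Mink d}
    (hv : ∀ x : EuclideanSpace ℝ (Fin d), ‖x‖ = 1 → form (x, 1) v = 0) : v = 0 := by
  simp only [form_mk_one, sub_eq_zero] at hv
  have hsnd : v.2 = 0 := by
    obtain ⟨x, hx⟩ := exists_norm_eq (EuclideanSpace ℝ (Fin d)) zero_le_one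
    have hneg := hv (-x) (by rwa [norm_neg])
    rw [inner_neg_left] at hneg
    linarith [hv x hx]
  refine Prod.ext (by_contra fun hfst => ?_) hsnd
  have hinner := hv (‖v.1‖⁻¹ • v.1) (norm_smul_inv_norm hfst)
  rw [real_inner_smul_left, real_inner_self_eq_norm_sq, hsnd] at hinner
  exact mul_ne_zero (inv_ne_zero (norm_ne_zero_iff.2 hfst))
    (pow_ne_zero 2 (norm_ne_zero_iff.2 hfst)) hinner

lemma OPlus.form_apply_left (A : OPlus d) (X Y : Mink d) :
    form (A.1 X) Y = form X ((A⁻¹).1 Y) := by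
  rw [← A.2.1 X]
  exact congrArg (form (A.1 X)) (A.1.apply_symm_apply Y).symm

lemma OPlus.continuous (A : OPlus d) : Continuous A.1 :=
  A.1.toLinearMap.continuous_of_finiteDimensional

end LorentzianForm

section Hyperboloid

lemma mem_hyperboloid_iff {X : Mink d} :
    X ∈ hyperboloid d ↔ ‖X.1‖ ^ 2 - X.2 ^ 2 = -1 ∧ 0 < X.2 := by
  rw [← form_self]
  rfl

lemma norm_fst_lt_snd {X : Mink d} (hX : X ∈ hyperboloid d) : ‖X.1‖ < X.2 := by
  obtain ⟨hform, hpos⟩ := mem_hyperboloid_iff.1 hX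
  exact lt_of_pow_lt_pow_left₀ 2 hpos.le (by linarith)

lemma zero_one_mem_hyperboloid : ((0, 1) : Mink d) ∈ hyperboloid d := by
  simp [mem_hyperboloid_iff]

lemma isClosed_hyperboloid : IsClosed (hyperboloid d) := by
  have hcone : hyperboloid d = {X | ‖X.1‖ ^ 2 - X.2 ^ 2 = -1} ∩ {X | ‖X.1‖ ≤ X.2} := by
    ext X
    refine ⟨fun hX => ⟨(mem_hyperboloid_iff.1 hX).1, (norm_fst_lt_snd hX).le⟩, fun hX => ?_⟩
    have hform : ‖X.1‖ ^ 2 - X.2 ^ 2 = -1 := hX.1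
    have hle : ‖X.1‖ ≤ X.2 := hX.2
    exact mem_hyperboloid_iff.2 ⟨hform, by nlinarith [norm_nonneg X.1]⟩
  rw [hcone]
  exact (isClosed_eq (by fun_prop) continuous_const).inter (isClosed_le (by fun_prop) (by fun_prop))

instance : LocallyCompactSpace (hyperboloid d) := isClosed_hyperboloid.locallyCompactSpace

instance (Γ : Subgroup (OPlus d)) : ContinuousConstSMul Γ (hyperboloid d) where
  continuous_const_smul A := ((OPlus.continuous A.1).comp continuous_subtype_val).subtype_mk _

lemma subsingleton_oPlus [Subsingleton (EuclideanSpace ℝ (Fin d))] : Subsingleton (OPlus d) := by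
  have fst_eq_zero (X : Mink d) : X.1 = 0 := Subsingleton.elim _ _
  have eq_smul (X : Mink d) : X = X.2 • (0, 1) := by
    ext1 <;> simp [fst_eq_zero]
  have apply_zero_one (A : OPlus d) : A.1 (0, 1) = (0, 1) := by
    obtain ⟨hform, hpos⟩ :=
      mem_hyperboloid_iff.1 ((A.2.2 (0, 1)).2 zero_one_mem_hyperboloid)
    rw [fst_eq_zero, norm_zero] at hform
    exact Prod.ext (fst_eq_zero _) (by dsimp only; nlinarith)
  refine ⟨fun A B => Subtype.ext (LinearEquiv.ext fun X => ?_)⟩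
  rw [eq_smul X, map_smul, map_smul, apply_zero_one, apply_zero_one]

end Hyperboloid

section KleinModel

variable {x y : EuclideanSpace ℝ (Fin d)}

lemma L_nonneg (x : EuclideanSpace ℝ (Fin d)) : 0 ≤ L x := Real.sqrt_nonneg _

lemma L_sq (hx : ‖x‖ ≤ 1) : L x ^ 2 = 1 - ‖x‖ ^ 2 :=
  Real.sq_sqrt (by nlinarith [norm_nonneg x])

lemma L_pos (hx : x ∈ ball 0 1) : 0 < L x :=
  Real.sqrt_pos.2 (by nlinarith [norm_nonneg x, mem_ball_zero_iff.1 hx])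

lemma L_eq_zero_of_norm_eq_one (hx : ‖x‖ = 1) : L x = 0 := by
  simp [L, hx]

lemma continuous_L : Continuous (L : EuclideanSpace ℝ (Fin d) → ℝ) := by
  unfold L
  fun_prop

/-- The factor `j(A, x)` with `A (x, 1) = j(A, x) • (A · x, 1)`. -/
def automorphyFactor (A : OPlus d) (x : EuclideanSpace ℝ (Fin d)) : ℝ := (A.1 (x, 1)).2

lemma continuous_automorphyFactor (A : OPlus d) : Continuous (automorphyFactor A) :=
  continuous_snd.comp ((OPlus.continuous A).comp (by fun_prop))

lemma automorphyFactor_pos (A : OPlus d) (hx : ‖x‖ ≤ 1) : 0 < automorphyFactor A x := by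
  set k := (A⁻¹).1 (0, 1)
  have hk : ‖k.1‖ < k.2 := norm_fst_lt_snd (((A⁻¹).2.2 (0, 1)).2 zero_one_mem_hyperboloid)
  have hfactor : automorphyFactor A x = k.2 - inner ℝ x k.1 := by
    rw [← neg_sub, ← form_mk_one, ← OPlus.form_apply_left A, form, automorphyFactor]
    simp
  rw [hfactor, sub_pos]
  calc inner ℝ x k.1 ≤ ‖x‖ * ‖k.1‖ := real_inner_le_norm _ _
    _ ≤ ‖k.1‖ := mul_le_of_le_one_left (norm_nonneg _) hx
    _ < k.2 := hk

lemma apply_mk_one (A : OPlus d) (hx : ‖x‖ ≤ 1) :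
    A.1 (x, 1) = automorphyFactor A x • (klein A x, 1) := by
  ext1
  · exact (smul_inv_smul₀ (automorphyFactor_pos A hx).ne' _).symm
  · exact (mul_one _).symm

lemma one_sub_inner_klein (A : OPlus d) (hx : ‖x‖ ≤ 1) (hy : ‖y‖ ≤ 1) :
    automorphyFactor A x * automorphyFactor A y * (1 - inner ℝ (klein A x) (klein A y)) =
      1 - inner ℝ x y := by
  have h := A.2.1 (x, 1) (y, 1)
  rw [apply_mk_one A hx, apply_mk_one A hy, form_smul_left, form_smul_right, form_mk_one,
    form_mk_one] at h
  linear_combination -h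

lemma automorphyFactor_sq_mul (A : OPlus d) (hx : ‖x‖ ≤ 1) :
    automorphyFactor A x ^ 2 * (1 - ‖klein A x‖ ^ 2) = 1 - ‖x‖ ^ 2 := by
  rw [← real_inner_self_eq_norm_sq, ← real_inner_self_eq_norm_sq, ← one_sub_inner_klein A hx hx,
    pow_two]

lemma automorphyFactor_mul_L (A : OPlus d) (hx : ‖x‖ ≤ 1) :
    automorphyFactor A x * L (klein A x) = L x := by
  rw [L, L, ← automorphyFactor_sq_mul A hx, Real.sqrt_mul (sq_nonneg _),
    Real.sqrt_sq (automorphyFactor_pos A hx).le]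

lemma norm_klein_eq_one (A : OPlus d) (hx : ‖x‖ = 1) : ‖klein A x‖ = 1 := by
  have h := automorphyFactor_sq_mul A hx.le
  rw [hx, one_pow, sub_self, mul_eq_zero, sub_eq_zero] at h
  have hsq := h.resolve_left (pow_ne_zero 2 (automorphyFactor_pos A hx.le).ne')
  exact (pow_eq_one_iff_of_nonneg (norm_nonneg _) two_ne_zero).1 hsq.symm

lemma klein_mem_ball (A : OPlus d) (hx : x ∈ ball 0 1) : klein A x ∈ ball 0 1 := by
  rw [mem_ball_zero_iff] at hx ⊢
  have hpos : 0 < 1 - ‖klein A x‖ ^ 2 := by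
    refine pos_of_mul_pos_right ?_ (sq_nonneg (automorphyFactor A x))
    rw [automorphyFactor_sq_mul A hx.le]
    nlinarith [norm_nonneg x]
  exact lt_of_pow_lt_pow_left₀ 2 zero_le_one (by linarith)

lemma klein_mem_closedBall (A : OPlus d) (hx : x ∈ closedBall 0 1) :
    klein A x ∈ closedBall 0 1 := by
  rcases (mem_closedBall_zero_iff.1 hx).lt_or_eq with hlt | heq
  · exact ball_subset_closedBall (klein_mem_ball A (mem_ball_zero_iff.2 hlt))
  · exact mem_closedBall_zero_iff.2 (norm_klein_eq_one A heq).le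

lemma continuousOn_klein (A : OPlus d) : ContinuousOn (klein A) (closedBall 0 1) :=
  ((continuous_automorphyFactor A).continuousOn.inv₀ fun _ hx =>
    (automorphyFactor_pos A (mem_closedBall_zero_iff.1 hx)).ne').smul
      (continuous_fst.comp ((OPlus.continuous A).comp (by fun_prop))).continuousOn

lemma act_eq (A : OPlus d) (v : Mink d) (h : EuclideanSpace ℝ (Fin d) → ℝ) (hx : x ∈ ball 0 1) :
    act A v h x = automorphyFactor A⁻¹ x * h (klein A⁻¹ x) + form (x, 1) v := by
  rw [act, form_mk_one, add_sub_assoc, ← automorphyFactor_mul_L A⁻¹ (mem_ball_zero_iff.1 hx).le,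
    mul_div_cancel_right₀ _ (L_pos (klein_mem_ball A⁻¹ hx)).ne']

/-- The point of the hyperboloid on the line through `(x, 1)`: the identification of the Klein ball
with the hyperboloid. -/
noncomputable def lift (x : EuclideanSpace ℝ (Fin d)) : Mink d := (L x)⁻¹ • (x, 1)

lemma lift_mem_hyperboloid (hx : x ∈ ball 0 1) : lift x ∈ hyperboloid d := by
  have hL := L_pos hx
  refine ⟨?_, by simpa [lift] using hL⟩
  rw [lift, form_smul_left, form_smul_right, form_self]
  field_simp
  linarith [L_sq (mem_ball_zero_iff.1 hx).le]

lemma L_mul_form_lift (hx : x ∈ ball 0 1) (v : Mink d) : L x * form (lift x) v = form (x, 1) v := by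
  rw [lift, form_smul_left, mul_inv_cancel_left₀ (L_pos hx).ne']

lemma lift_klein (A : OPlus d) (hx : x ∈ ball 0 1) : lift (klein A x) = A.1 (lift x) := by
  have hx1 := (mem_ball_zero_iff.1 hx).le
  have hj := (automorphyFactor_pos A hx1).ne'
  rw [lift, lift, map_smul, apply_mk_one A hx1, ← automorphyFactor_mul_L A hx1, mul_inv, smul_smul,
    mul_assoc, mul_comm (L _)⁻¹, inv_mul_cancel_left₀ hj]

lemma continuousOn_lift : ContinuousOn (lift : EuclideanSpace ℝ (Fin d) → Mink d) (ball 0 1) :=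
  (continuous_L.continuousOn.inv₀ fun _ hx => (L_pos hx).ne').smul (by fun_prop)

/-- The hypothesis bounds the hyperbolic distance of `x` and `y`, whose hyperbolic cosine is
`(1 - ⟪x, y⟫) / (L x * L y)`. -/
lemma L_le_of_one_sub_inner_le {a : ℝ} (hx : x ∈ ball 0 1) (hy : y ∈ ball 0 1)
    (hxy : 1 - inner ℝ x y ≤ a * (L x * L y)) : L x ≤ 2 * a * L y := by
  have hx1 := mem_ball_zero_iff.1 hx
  have hinner : inner ℝ x y ≤ ‖x‖ := (real_inner_le_norm x y).trans
    (mul_le_of_le_one_right (norm_nonneg x) (mem_ball_zero_iff.1 hy).le)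
  refine le_of_mul_le_mul_left ?_ (L_pos hx)
  nlinarith [L_sq hx1.le, norm_nonneg x]

lemma L_klein_le {a : ℝ} (A : OPlus d) (hx : x ∈ ball 0 1) (hy : y ∈ ball 0 1)
    (hxy : 1 - inner ℝ x y ≤ a * (L x * L y)) : L (klein A x) ≤ 2 * a * L (klein A y) := by
  have hx1 := (mem_ball_zero_iff.1 hx).le
  have hy1 := (mem_ball_zero_iff.1 hy).le
  refine L_le_of_one_sub_inner_le (klein_mem_ball A hx) (klein_mem_ball A hy) ?_
  refine le_of_mul_le_mul_left ?_
    (mul_pos (automorphyFactor_pos A hx1) (automorphyFactor_pos A hy1))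
  rw [one_sub_inner_klein A hx1 hy1]
  calc 1 - inner ℝ x y ≤ a * (L x * L y) := hxy
    _ = _ := by rw [← automorphyFactor_mul_L A hx1, ← automorphyFactor_mul_L A hy1]; ring

end KleinModel

section EquivariantMaps

variable {Γ : Subgroup (OPlus d)} {σ τ : cocycles Γ} {h k : EuclideanSpace ℝ (Fin d) → ℝ}

lemma isEquivariant_iff : IsEquivariant τ h ↔ ContinuousOn h (ball 0 1) ∧
    ∀ A : Γ, ∀ x ∈ ball (0 : EuclideanSpace ℝ (Fin d)) 1,
      h x = automorphyFactor A.1⁻¹ x * h (klein A.1⁻¹ x) + form (x, 1) (τ.1 A) :=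
  and_congr_right' <| forall₃_congr fun A x hx => by rw [act_eq _ _ _ hx, eq_comm]

lemma IsEquivariant.add (hh : IsEquivariant σ h) (hk : IsEquivariant τ k) :
    IsEquivariant (σ + τ) (h + k) := by
  refine isEquivariant_iff.2 ⟨hh.1.add hk.1, fun A x hx => ?_⟩
  have hσ := (isEquivariant_iff.1 hh).2 A x hx
  have hτ := (isEquivariant_iff.1 hk).2 A x hx
  rw [Submodule.coe_add, Pi.add_apply, Pi.add_apply, Pi.add_apply, form_add_right]
  linear_combination hσ + hτ

lemma IsEquivariant.smul (hh : IsEquivariant τ h) (a : ℝ) : IsEquivariant (a • τ) (a • h) := by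
  refine isEquivariant_iff.2 ⟨hh.1.const_smul a, fun A x hx => ?_⟩
  have hτ := (isEquivariant_iff.1 hh).2 A x hx
  rw [Submodule.coe_smul, Pi.smul_apply, Pi.smul_apply, Pi.smul_apply, form_smul_right, smul_eq_mul,
    smul_eq_mul]
  linear_combination a * hτ

lemma IsEquivariant.sub (hh : IsEquivariant σ h) (hk : IsEquivariant τ k) :
    IsEquivariant (σ - τ) (h - k) := by
  rw [show σ - τ = σ + (-1 : ℝ) • τ by module, show h - k = h + (-1 : ℝ) • k by module]
  exact hh.add (hk.smul (-1))

lemma cocycles_apply_one (τ : cocycles Γ) : τ.1 1 = 0 := by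
  have h := τ.2 1 1
  rw [mul_one] at h
  exact left_eq_add.1 h

/-- The coboundary `A ↦ A v - v` of the vector `v`, as an element of the space of cocycles. -/
def coboundary (Γ : Subgroup (OPlus d)) (v : Mink d) : cocycles Γ :=
  ⟨fun A => A.1.1 v - v, fun A B => by
    change A.1.1 (B.1.1 v) - v = A.1.1 v - v + A.1.1 (B.1.1 v - v)
    rw [map_sub]
    abel⟩

lemma isCoboundary_iff : IsCoboundary τ ↔ ∃ v, τ = coboundary Γ v :=
  exists_congr fun _ => ⟨fun h => Subtype.ext (funext h), fun h A => congrFun (congrArg _ h) A⟩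

lemma isEquivariant_coboundary (Γ : Subgroup (OPlus d)) (v : Mink d) :
    IsEquivariant (coboundary Γ v) fun x => -form (x, 1) v := by
  refine isEquivariant_iff.2 ⟨(continuous_form_mk_one v).neg.continuousOn, fun A x hx => ?_⟩
  have hform : form (x, 1) (A.1.1 v) = automorphyFactor A.1⁻¹ x * form (klein A.1⁻¹ x, 1) v := by
    rw [← form_smul_left, ← apply_mk_one _ (mem_ball_zero_iff.1 hx).le, OPlus.form_apply_left,
      inv_inv]
  rw [show (coboundary Γ v).1 A = A.1.1 v - v from rfl, form_sub_right, hform]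
  ring

variable [CompactSpace (Quotient (MulAction.orbitRel Γ (hyperboloid d)))]

lemma exists_isEquivariant [ProperlyDiscontinuousSMul Γ (hyperboloid d)] (τ : cocycles Γ) :
    ∃ h, IsEquivariant τ h := by
  obtain ⟨u, hu, huτ⟩ := exists_continuous_eq_inv_smul_add (G := Γ) (X := hyperboloid d)
    (c := fun A X => form X.1 (τ.1 A))
    (fun A => (continuous_form_left _).comp continuous_subtype_val) fun A B X => by
      rw [τ.2 A B, form_add_right]
      exact congrArg _ (OPlus.form_apply_left A.1⁻¹ X.1 (τ.1 B)).symm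
  obtain ⟨U, hU⟩ := ContinuousMap.exists_restrict_eq isClosed_hyperboloid ⟨u, hu⟩
  have hUu (X : hyperboloid d) : U X = u X := DFunLike.congr_fun hU X
  refine ⟨fun x => L x * U (lift x), isEquivariant_iff.2
    ⟨continuous_L.continuousOn.mul (U.continuous.comp_continuousOn continuousOn_lift),
      fun A x hx => ?_⟩⟩
  have hUlift : U (lift x) = U ((A.1⁻¹).1 (lift x)) + form (lift x) (τ.1 A) := by
    have := huτ A ⟨lift x, lift_mem_hyperboloid hx⟩
    rwa [← hUu, ← hUu] at this
  rw [hUlift, mul_add, L_mul_form_lift hx, lift_klein _ hx,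
    ← automorphyFactor_mul_L A.1⁻¹ (mem_ball_zero_iff.1 hx).le, mul_assoc]

variable (Γ) in
lemma exists_forall_exists_le_L_klein :
    ∃ ε > 0, ∀ x ∈ ball (0 : EuclideanSpace ℝ (Fin d)) 1, ∃ A : Γ, ε ≤ L (klein A.1 x) := by
  obtain ⟨K, hK, hKΓ⟩ := exists_isCompact_forall_exists_smul_mem (G := Γ) (X := hyperboloid d)
  obtain ⟨c, hc⟩ := hK.bddAbove_image (f := fun X => X.1.2)
    (continuous_snd.comp continuous_subtype_val).continuousOn
  refine ⟨(max c 1)⁻¹, by positivity, fun x hx => ?_⟩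
  obtain ⟨A, hA⟩ := hKΓ ⟨lift x, lift_mem_hyperboloid hx⟩
  have hheight : (L (klein A.1 x))⁻¹ ≤ c := by
    have : (lift (klein A.1 x)).2 ≤ c := by
      rw [lift_klein A.1 hx]
      exact hc ⟨_, hA, rfl⟩
    simpa [lift] using this
  exact ⟨A, inv_le_of_inv_le₀ (L_pos (klein_mem_ball A.1 hx)) (hheight.trans (le_max_left _ _))⟩

end EquivariantMaps

section RadialBehaviour

variable {ω : EuclideanSpace ℝ (Fin d)} {s t : ℝ}

lemma one_sub_smul_mem_ball (hω : ‖ω‖ = 1) (ht0 : 0 < t) (ht1 : t ≤ 1) :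
    (1 - t) • ω ∈ ball 0 1 := by
  rw [mem_ball_zero_iff, norm_smul, hω, mul_one, Real.norm_of_nonneg (by linarith)]
  linarith

lemma L_one_sub_smul (hω : ‖ω‖ = 1) (t : ℝ) : L ((1 - t) • ω) = √(t * (2 - t)) := by
  rw [L, norm_smul, hω, mul_one, Real.norm_eq_abs, sq_abs]
  ring_nf

lemma sqrt_le_L_one_sub_smul (hω : ‖ω‖ = 1) (ht0 : 0 ≤ t) (ht1 : t ≤ 1) :
    √t ≤ L ((1 - t) • ω) := by
  rw [L_one_sub_smul hω]
  exact Real.sqrt_le_sqrt (by nlinarith)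

lemma L_one_sub_smul_le (hω : ‖ω‖ = 1) (ht0 : 0 ≤ t) : L ((1 - t) • ω) ≤ 2 * √t := by
  rw [L_one_sub_smul hω, Real.sqrt_le_left (by positivity), mul_pow, Real.sq_sqrt ht0]
  nlinarith

lemma one_sub_inner_one_sub_smul_le (hω : ‖ω‖ = 1) (hs0 : 0 ≤ s) (hs1 : s ≤ 1) (hst : s / 4 ≤ t)
    (hts : t ≤ s) :
    1 - inner ℝ ((1 - s) • ω) ((1 - t) • ω) ≤ 4 * (L ((1 - s) • ω) * L ((1 - t) • ω)) := by
  have hsqrt : √s / 2 ≤ √t := by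
    rw [Real.le_sqrt (by positivity) (by linarith), div_pow, Real.sq_sqrt hs0]
    linarith
  rw [real_inner_smul_left, real_inner_smul_right, real_inner_self_eq_norm_sq, hω]
  calc 1 - (1 - s) * ((1 - t) * 1 ^ 2) ≤ 4 * (√s * (√s / 2)) := by
        nlinarith [Real.mul_self_sqrt hs0]
    _ ≤ 4 * (L ((1 - s) • ω) * L ((1 - t) • ω)) := by
        gcongr
        · exact L_nonneg _
        · exact sqrt_le_L_one_sub_smul hω hs0 hs1
        · exact hsqrt.trans (sqrt_le_L_one_sub_smul hω (by linarith) (by linarith))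

end RadialBehaviour

section BoundaryExtension

variable {Γ : Subgroup (OPlus d)} {σ τ : cocycles Γ} {h k : EuclideanSpace ℝ (Fin d) → ℝ}

lemma exists_forall_abs_le_mul_L (hh : ContinuousOn h (ball 0 1)) {δ : ℝ} (hδ : 0 < δ) :
    ∃ C ≥ 0, ∀ x ∈ ball 0 1, δ ≤ L x → |h x| ≤ C * L x := by
  have hcompact : IsCompact (closedBall (0 : EuclideanSpace ℝ (Fin d)) 1 ∩ {x | δ ≤ L x}) :=
    (isCompact_closedBall 0 1).inter_right (isClosed_le continuous_const continuous_L)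
  have hsub : closedBall (0 : EuclideanSpace ℝ (Fin d)) 1 ∩ {x | δ ≤ L x} ⊆ ball 0 1 := by
    rintro x ⟨hx, hδx⟩
    refine mem_ball_zero_iff.2 ((mem_closedBall_zero_iff.1 hx).lt_of_ne fun hx1 => ?_)
    exact (hδ.trans_le hδx).ne' (L_eq_zero_of_norm_eq_one hx1)
  obtain ⟨M, hM⟩ := hcompact.exists_bound_of_continuousOn (hh.mono hsub)
  refine ⟨max M 0 / δ, by positivity, fun x hx hδx => ?_⟩
  calc |h x| ≤ max M 0 := (hM x ⟨ball_subset_closedBall hx, hδx⟩).trans (le_max_left _ _)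
    _ = max M 0 / δ * δ := (div_mul_cancel₀ _ hδ.ne').symm
    _ ≤ max M 0 / δ * L x := by gcongr

lemma ExtendsAs.unique {b c : C(sphere (0 : EuclideanSpace ℝ (Fin d)) 1, ℝ)}
    (hb : ExtendsAs h b) (hc : ExtendsAs h c) : b = c := by
  obtain ⟨H, hH, hHh, hHb⟩ := hb
  obtain ⟨G, hG, hGh, hGc⟩ := hc
  have heq : Set.EqOn H G (closedBall 0 1) :=
    Set.EqOn.of_subset_closure (fun x hx => (hHh x hx).trans (hGh x hx).symm) hH hG
      ball_subset_closedBall (closure_ball _ one_ne_zero).ge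
  ext x
  rw [← hHb, ← hGc, heq (sphere_subset_closedBall x.2)]

lemma ExtendsAs.add {b c : C(sphere (0 : EuclideanSpace ℝ (Fin d)) 1, ℝ)} (hb : ExtendsAs h b)
    (hc : ExtendsAs k c) : ExtendsAs (h + k) (b + c) := by
  obtain ⟨H, hH, hHh, hHb⟩ := hb
  obtain ⟨G, hG, hGh, hGc⟩ := hc
  exact ⟨H + G, hH.add hG, fun x hx => congrArg₂ _ (hHh x hx) (hGh x hx),
    fun x => congrArg₂ _ (hHb x) (hGc x)⟩

lemma ExtendsAs.smul {b : C(sphere (0 : EuclideanSpace ℝ (Fin d)) 1, ℝ)} (hb : ExtendsAs h b)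
    (a : ℝ) : ExtendsAs (a • h) (a • b) := by
  obtain ⟨H, hH, hHh, hHb⟩ := hb
  exact ⟨a • H, hH.const_smul a, fun x hx => congrArg _ (hHh x hx), fun x => congrArg _ (hHb x)⟩

variable [CompactSpace (Quotient (MulAction.orbitRel Γ (hyperboloid d)))]

/-- The group moves `x` into a fixed compact set, on which `h / L` is bounded; moving back changes
`h` by the affine function of a value of the cocycle. -/
lemma IsEquivariant.exists_form_approx (hh : IsEquivariant τ h) {a : ℝ} (ha : 0 < a) :
    ∃ C ≥ 0, ∀ x ∈ ball 0 1, ∃ A : Γ, ∀ y ∈ ball 0 1, 1 - inner ℝ x y ≤ a * (L x * L y) →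
      |h y - form (y, 1) (τ.1 A)| ≤ C * L y := by
  obtain ⟨ε, hε, hεΓ⟩ := exists_forall_exists_le_L_klein Γ
  obtain ⟨C, hC0, hC⟩ := exists_forall_abs_le_mul_L hh.1 (δ := ε / (2 * a)) (by positivity)
  refine ⟨C, hC0, fun x hx => ?_⟩
  obtain ⟨A, hA⟩ := hεΓ x hx
  refine ⟨A⁻¹, fun y hy hxy => ?_⟩
  have hy1 := (mem_ball_zero_iff.1 hy).le
  have hfar : ε / (2 * a) ≤ L (klein A.1 y) :=
    (div_le_iff₀' (by positivity)).2 (hA.trans (L_klein_le A.1 hx hy hxy))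
  have heq : h y = automorphyFactor A.1 y * h (klein A.1 y) + form (y, 1) (τ.1 A⁻¹) := by
    simpa only [InvMemClass.coe_inv, inv_inv] using (isEquivariant_iff.1 hh).2 A⁻¹ y hy
  calc |h y - form (y, 1) (τ.1 A⁻¹)| = automorphyFactor A.1 y * |h (klein A.1 y)| := by
        rw [heq, add_sub_cancel_right, abs_mul, abs_of_pos (automorphyFactor_pos A.1 hy1)]
    _ ≤ automorphyFactor A.1 y * (C * L (klein A.1 y)) :=
        mul_le_mul_of_nonneg_left (hC _ (klein_mem_ball A.1 hy) hfar)
          (automorphyFactor_pos A.1 hy1).le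
    _ = C * L y := by rw [← automorphyFactor_mul_L A.1 hy1]; ring

lemma IsEquivariant.exists_affine_approx_radial (hh : IsEquivariant τ h) :
    ∃ C : ℝ, ∀ ω : EuclideanSpace ℝ (Fin d), ‖ω‖ = 1 → ∀ s, 0 < s → s ≤ 1 →
      ∃ p q : ℝ, ∀ t, s / 4 ≤ t → t ≤ s → |h ((1 - t) • ω) - (p + q * t)| ≤ C * √s := by
  obtain ⟨C, hC0, hC⟩ := hh.exists_form_approx (a := 4) (by norm_num)
  refine ⟨C * 2, fun ω hω s hs0 hs1 => ?_⟩
  obtain ⟨A, hA⟩ := hC _ (one_sub_smul_mem_ball hω hs0 hs1)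
  set v := τ.1 A
  refine ⟨inner ℝ ω v.1 - v.2, -inner ℝ ω v.1, fun t hst hts => ?_⟩
  have hform : form ((1 - t) • ω, 1) v = inner ℝ ω v.1 - v.2 + -inner ℝ ω v.1 * t := by
    rw [form_mk_one, real_inner_smul_left]
    ring
  rw [← hform]
  calc |h ((1 - t) • ω) - form ((1 - t) • ω, 1) v| ≤ C * L ((1 - t) • ω) :=
        hA _ (one_sub_smul_mem_ball hω (by linarith) (hts.trans hs1))
          (one_sub_inner_one_sub_smul_le hω hs0.le hs1 hst hts)
    _ ≤ C * (2 * √s) := by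
        gcongr
        exact (L_one_sub_smul_le hω (by linarith)).trans (by gcongr)
    _ = C * 2 * √s := by ring

lemma IsEquivariant.exists_abs_sub_radial_le (hh : IsEquivariant τ h) :
    ∃ K : ℝ, ∀ ω : EuclideanSpace ℝ (Fin d), ‖ω‖ = 1 → ∀ s t, 0 < t → t ≤ s → s ≤ 1 →
      |h ((1 - t) • ω) - h ((1 - s) • ω)| ≤ K * √s := by
  obtain ⟨C, hC⟩ := hh.exists_affine_approx_radial
  obtain ⟨M, hM⟩ := (isCompact_closedBall 0 (3 / 4)).exists_bound_of_continuousOn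
    (hh.1.mono (closedBall_subset_ball (by norm_num)))
  obtain ⟨K, hK⟩ := exists_forall_abs_sub_le_rpow (γ := 1 / 2) (by norm_num) (by norm_num) C M
  simp only [← Real.sqrt_eq_rpow] at hK
  refine ⟨K, fun ω hω => hK (fun t => h ((1 - t) • ω)) (hC ω hω) fun s hs hs1 => hM _ ?_⟩
  rw [mem_closedBall_zero_iff, norm_smul, hω, mul_one, Real.norm_of_nonneg (by linarith)]
  linarith

lemma IsEquivariant.uniformContinuousOn (hh : IsEquivariant τ h) :
    UniformContinuousOn h (ball 0 1) := by
  obtain ⟨K, hK⟩ := hh.exists_abs_sub_radial_le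
  refine uniformContinuousOn_ball_of_radial hh.1 fun ε hε => ?_
  have hlim : Tendsto (fun s => K * √s) (𝓝[>] 0) (𝓝 0) := by
    have hcont : Continuous fun s => K * √s := by fun_prop
    simpa using (hcont.tendsto 0).mono_left nhdsWithin_le_nhds
  obtain ⟨s, hsK, hs0, hs1⟩ :=
    ((hlim.eventually_le_const hε).and (Ioo_mem_nhdsGT (zero_lt_one' ℝ))).exists
  exact ⟨s, hs0, hs1, fun ω hω t ht0 hts => (hK ω hω s t ht0 hts hs1.le).trans hsK⟩

lemma IsEquivariant.exists_extendsAs (hh : IsEquivariant τ h) : ∃ b, ExtendsAs h b := by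
  have hclosure := closure_ball (0 : EuclideanSpace ℝ (Fin d)) one_ne_zero
  have hcont : ContinuousOn (extendFrom (ball 0 1) h) (closedBall 0 1) :=
    continuousOn_extendFrom hclosure.ge fun x hx =>
      exists_tendsto_of_uniformContinuousOn hh.uniformContinuousOn (hclosure.ge hx)
  exact ⟨⟨fun x => extendFrom (ball 0 1) h x,
    hcont.comp_continuous continuous_subtype_val fun x => sphere_subset_closedBall x.2⟩,
    _, hcont, fun x hx => extendFrom_eq (subset_closure hx) (hh.1 x hx), fun _ => rfl⟩

lemma IsEquivariant.extendsAs_zero (hh : IsEquivariant (0 : cocycles Γ) h) : ExtendsAs h 0 := by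
  obtain ⟨b, H, hH, hHh, -⟩ := hh.exists_extendsAs
  obtain ⟨C, -, hC⟩ := hh.exists_form_approx one_pos
  have hle (x : EuclideanSpace ℝ (Fin d)) (hx : x ∈ closedBall 0 1) : |H x| ≤ C * L x := by
    rw [← closure_ball _ one_ne_zero] at hx
    refine ContinuousWithinAt.closure_le (f := fun y => |H y|) (g := fun y => C * L y) hx ?_
      (continuous_L.const_mul C).continuousWithinAt fun y hy => ?_
    · exact ((hH.mono (closure_ball _ one_ne_zero).le).abs x hx).mono subset_closure
    · obtain ⟨A, hA⟩ := hC y hy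
      have hyy : 1 - inner ℝ y y ≤ 1 * (L y * L y) := by
        rw [real_inner_self_eq_norm_sq, ← L_sq (mem_ball_zero_iff.1 hy).le, one_mul, pow_two]
      simpa [hHh y hy, form_zero_right] using hA y hy hyy
  refine ⟨H, hH, hHh, fun x => abs_nonpos_iff.1 ((hle x (sphere_subset_closedBall x.2)).trans ?_)⟩
  rw [L_eq_zero_of_norm_eq_one (mem_sphere_zero_iff_norm.1 x.2), mul_zero]

end BoundaryExtension

section BoundaryMap

variable {Γ : Subgroup (OPlus d)} {τ : cocycles Γ} {h : EuclideanSpace ℝ (Fin d) → ℝ}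

lemma isAffineRestriction_iff {b : C(sphere (0 : EuclideanSpace ℝ (Fin d)) 1, ℝ)} :
    IsAffineRestriction b ↔
      ∃ v : Mink d, ∀ x : sphere (0 : EuclideanSpace ℝ (Fin d)) 1, b x = -form (x.1, 1) v := by
  simp only [form_mk_one, neg_sub]
  constructor
  · rintro ⟨f, hf⟩
    set φ := LinearMap.toContinuousLinearMap f.linear
    refine ⟨(-(InnerProductSpace.toDual ℝ _).symm φ, f 0), fun x => ?_⟩
    have hφ : inner ℝ x.1 ((InnerProductSpace.toDual ℝ _).symm φ) = f.linear x := by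
      rw [real_inner_comm, InnerProductSpace.toDual_symm_apply]
      rfl
    rw [hf, inner_neg_right, hφ, sub_neg_eq_add, add_comm]
    exact congrFun f.decomp x
  · rintro ⟨v, hv⟩
    refine ⟨AffineMap.const ℝ _ v.2 - (innerₗ _ v.1).toAffineMap, fun x => ?_⟩
    simp [hv, real_inner_comm]

lemma IsEquivariant.eqOn_closedBall (hh : IsEquivariant τ h) {H : EuclideanSpace ℝ (Fin d) → ℝ}
    (hH : ContinuousOn H (closedBall 0 1)) (hHh : Set.EqOn H h (ball 0 1)) (A : Γ) :
    Set.EqOn H (fun x => automorphyFactor A.1⁻¹ x * H (klein A.1⁻¹ x) + form (x, 1) (τ.1 A))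
      (closedBall 0 1) := by
  refine Set.EqOn.of_subset_closure (s := ball 0 1) (fun x hx => ?_) hH ?_ ball_subset_closedBall
    (closure_ball _ one_ne_zero).ge
  · rw [hHh hx, hHh (klein_mem_ball _ hx)]
    exact (isEquivariant_iff.1 hh).2 A x hx
  · exact ((continuous_automorphyFactor _).continuousOn.mul (hH.comp (continuousOn_klein _)
      fun x hx => klein_mem_closedBall _ hx)).add (continuous_form_mk_one _).continuousOn

lemma IsEquivariant.form_eq_zero_of_extendsAs_zero (hh : IsEquivariant τ h) (hb : ExtendsAs h 0)
    (A : Γ) {x : EuclideanSpace ℝ (Fin d)} (hx : ‖x‖ = 1) : form (x, 1) (τ.1 A) = 0 := by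
  obtain ⟨H, hH, hHh, hH0⟩ := hb
  have hzero (y : EuclideanSpace ℝ (Fin d)) (hy : ‖y‖ = 1) : H y = 0 :=
    hH0 ⟨y, mem_sphere_zero_iff_norm.2 hy⟩
  have heq := hh.eqOn_closedBall hH hHh A (mem_closedBall_zero_iff.2 hx.le)
  simpa [hzero x hx, hzero _ (norm_klein_eq_one A.1⁻¹ hx)] using heq.symm

variable [ProperlyDiscontinuousSMul Γ (hyperboloid d)]
  [CompactSpace (Quotient (MulAction.orbitRel Γ (hyperboloid d)))]

lemma exists_forall_extendsAs (τ : cocycles Γ) : ∃ b, ∀ h, IsEquivariant τ h → ExtendsAs h b := by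
  obtain ⟨h₀, hh₀⟩ := exists_isEquivariant τ
  obtain ⟨b, hb⟩ := hh₀.exists_extendsAs
  refine ⟨b, fun h hh => ?_⟩
  have hdiff : IsEquivariant (0 : cocycles Γ) (h - h₀) := by simpa using hh.sub hh₀
  simpa using hdiff.extendsAs_zero.add hb

variable (Γ) in
/-- The linear map `τ ↦ b_τ` from cocycles to the common boundary values of their equivariant
maps. -/
noncomputable def boundaryMap :
    cocycles Γ →ₗ[ℝ] C(sphere (0 : EuclideanSpace ℝ (Fin d)) 1, ℝ) where
  toFun τ := (exists_forall_extendsAs τ).choose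
  map_add' σ τ := by
    obtain ⟨h, hh⟩ := exists_isEquivariant σ
    obtain ⟨k, hk⟩ := exists_isEquivariant τ
    exact ((exists_forall_extendsAs (σ + τ)).choose_spec _ (hh.add hk)).unique
      (((exists_forall_extendsAs σ).choose_spec h hh).add
        ((exists_forall_extendsAs τ).choose_spec k hk))
  map_smul' a τ := by
    obtain ⟨h, hh⟩ := exists_isEquivariant τ
    exact ((exists_forall_extendsAs (a • τ)).choose_spec _ (hh.smul a)).unique
      (((exists_forall_extendsAs τ).choose_spec h hh).smul a)

lemma IsEquivariant.extendsAs_boundaryMap (hh : IsEquivariant τ h) :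
    ExtendsAs h (boundaryMap Γ τ) :=
  (exists_forall_extendsAs τ).choose_spec h hh

variable (Γ) in
lemma boundaryMap_coboundary (v : Mink d) (x : sphere (0 : EuclideanSpace ℝ (Fin d)) 1) :
    boundaryMap Γ (coboundary Γ v) x = -form (x.1, 1) v := by
  have hcont : Continuous fun x : EuclideanSpace ℝ (Fin d) => -form (x, 1) v :=
    (continuous_form_mk_one v).neg
  have heq : boundaryMap Γ (coboundary Γ v) = ⟨_, hcont.comp continuous_subtype_val⟩ :=
    (isEquivariant_coboundary Γ v).extendsAs_boundaryMap.unique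
      ⟨_, hcont.continuousOn, fun _ _ => rfl, fun _ => rfl⟩
  rw [heq]
  rfl

variable (Γ) in
lemma boundaryMap_injective : Injective (boundaryMap Γ) := by
  refine (injective_iff_map_eq_zero _).2 fun τ hτ => Subtype.ext (funext fun A => ?_)
  rcases subsingleton_or_nontrivial (EuclideanSpace ℝ (Fin d)) with _ | _
  · have := subsingleton_oPlus (d := d)
    rw [Subsingleton.elim A 1]
    exact cocycles_apply_one τ
  · obtain ⟨h, hh⟩ := exists_isEquivariant τ
    exact eq_zero_of_forall_form_eq_zero fun x hx =>
      hh.form_eq_zero_of_extendsAs_zero (hτ ▸ hh.extendsAs_boundaryMap) A hx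

theorem isCoboundary_iff_isAffineRestriction :
    IsCoboundary τ ↔ IsAffineRestriction (boundaryMap Γ τ) := by
  simp only [isCoboundary_iff, isAffineRestriction_iff, ← (boundaryMap_injective Γ).eq_iff,
    ContinuousMap.ext_iff, boundaryMap_coboundary]

end BoundaryMap

end CoMinkowski

open CoMinkowski in
theorem mainTheorem7 (d : ℕ) (Γ : Subgroup (OPlus d))
    (hdisc : ProperlyDiscontinuousSMul Γ (hyperboloid d))
    (hcomp : CompactSpace (Quotient (MulAction.orbitRel Γ (hyperboloid d)))) :
    ∃ b : cocycles Γ → C(Metric.sphere (0 : EuclideanSpace ℝ (Fin d)) 1, ℝ),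
      (∀ τ, (∃ h, IsEquivariant τ h) ∧ ∀ h, IsEquivariant τ h → ExtendsAs h (b τ)) ∧
      (∀ τ c, (∀ h, IsEquivariant τ h → ExtendsAs h c) → c = b τ) ∧
      (∀ (τ₁ τ₂ : cocycles Γ) (α : ℝ), b (α • τ₁ + τ₂) = α • b τ₁ + b τ₂) ∧
      ∀ τ, IsCoboundary τ ↔ IsAffineRestriction (b τ) := by
  refine ⟨boundaryMap Γ, fun τ => ⟨exists_isEquivariant τ, fun h hh => hh.extendsAs_boundaryMap⟩,
    fun τ c hc => ?_, fun τ₁ τ₂ α => ?_, fun τ => isCoboundary_iff_isAffineRestriction⟩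
  · obtain ⟨h, hh⟩ := exists_isEquivariant τ
    exact (hc h hh).unique hh.extendsAs_boundaryMap
  · rw [map_add, map_smul]
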